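/- Let $q$ be an odd prime power, a power of the prime $p$, that can be written as $q=(2a+1)m-1$ with integers $a\ge 0$ and $m\ge 1$. Then for every integer $d$ with $2\le d\le (a+1)m-1$ there exists a $q$-ary quantum MDS code with parameters $$\left[\left[\frac{q^2-1}{2a+1}-q+1,\ \frac{q^2-1}{2a+1}-q-2d+3,\ d\right]\right]_q .$$ Here a $q$-ary $[[n,k,d]]_q$ quantum code is a subspace $Q$ of dimension $q^k$ of $(\mathbb C^q)^{\otimes n}\cong\mathbb C^{q^n}$, the Hermitian space with orthonormal basis $\{|x\rangle : x\in\mathbb F_q^n\}$, whose minimum distance is $d$. The minimum distance refers to the errors $e=\zeta_p^{l}T^{\mathbf a}R^{\mathbf b}$ with $0\le l\le p-1$ and $\mathbf a,\mathbf b\in\mathbb F_q^n$, given by $e|x\rangle=\zeta_p^{\,l+\mathrm{Tr}_{\mathbb F_q/\mathbb F_p}(\mathbf b\cdot x)}|x+\mathbf a\rangle$, where $\zeta_p$ is a primitive complex $p$-th root of unity. The weight of $e$ is the number of positions $i$ with $(a_i,b_i)\ne(0,0)$, and $Q$ detects $e$ if there is $c\in\mathbb C$ with $\langle u|e|v\rangle=c\,\langle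 u|v\rangle$ for all $u,v\in Q$. If $\dim Q>1$, then $Q$ has minimum distance $d$ if it detects all errors of weight less than $d$ but fails to detect some error of weight $d$. If $\dim Q=1$ (that is, $k=0$), every error is detected, and, as usual, the minimum distance is defined as the least positive weight of an error $e$ with $\langle u|e|v\rangle\neq 0$ for some $u,v\in Q$. An $[[n,k,d]]_q$ code is MDS if it attains the quantum Singleton bound, i.e. $2d=n-k+2$. -/

import Mathlib

namespace QuantumMDS

/-- The state space `(ℂ^q)^{⊗ n} ≅ ℂ^(q^n)`, with its standard Hermitian inner product and the
orthonormal basis `|x⟩`, `x ∈ F^n`; here `F` is the field with `q` elements. -/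
abbrev StateSpace (F : Type*) [Fintype F] (n : ℕ) : Type _ :=
  EuclideanSpace ℂ (Fin n → F)

/-- An element `ζ^l T^a R^b` of the error group `E_n`, given by `l ∈ {0, …, p-1}` and
`a, b ∈ F^n`. -/
structure PauliError (p : ℕ) (F : Type*) (n : ℕ) where
  /-- the exponent `l` of the phase -/
  phase : Fin p
  /-- the vector `a` of `T^a` -/
  shift : Fin n → F
  /-- the vector `b` of `R^b` -/
  clock : Fin n → F

section

variable {p : ℕ} {F : Type*} [Field F] [Fintype F] {n : ℕ}

/-- The operator `ζ^l T^a R^b` on the state space, in coordinates: the coefficient at `y` of the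
image of `ψ` is `ζ^(l + Tr(b · (y - a))) ψ(y - a)`.  Equivalently (`PauliError.op_single`)
`|x⟩ ↦ ζ^(l + Tr(b · x)) |x + a⟩`. -/
noncomputable def PauliError.op [Algebra (ZMod p) F] (ζ : ℂ) (e : PauliError p F n) :
    StateSpace F n →ₗ[ℂ] StateSpace F n where
  toFun ψ := WithLp.toLp 2 fun y =>
    ζ ^ ((e.phase : ℕ) + (Algebra.trace (ZMod p) F (∑ i, e.clock i * (y i - e.shift i))).val)
      * ψ (y - e.shift)
  map_add' ψ φ := by
    ext y
    simp [mul_add]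
  map_smul' c ψ := by
    ext y
    simp [mul_left_comm]

theorem PauliError.op_single [DecidableEq F] [Algebra (ZMod p) F] (ζ : ℂ)
    (e : PauliError p F n) (x : Fin n → F) :
    e.op ζ (EuclideanSpace.single x 1) =
      ζ ^ ((e.phase : ℕ) + (Algebra.trace (ZMod p) F (∑ i, e.clock i * x i)).val) •
        EuclideanSpace.single (x + e.shift) (1 : ℂ) := by
  ext y
  by_cases h : y = x + e.shift
  · subst h
    simp [PauliError.op]
  · have h' : ¬ (y - e.shift = x) := fun h' => h (by rw [← h']; simp)
    simp [PauliError.op, h, h']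

/-- The quantum weight: the number of positions `i` with `(a_i, b_i) ≠ (0, 0)`. -/
def PauliError.weight [DecidableEq F] (e : PauliError p F n) : ℕ :=
  (Finset.univ.filter fun i => (e.shift i, e.clock i) ≠ (0, 0)).card

/-- The code `Q` detects the operator `E`: `P E P = c P` for some scalar `c`, where `P` is the
orthogonal projection onto `Q`; that is, `⟨u | E | v⟩ = c ⟨u | v⟩` for all `u, v ∈ Q`. -/
def Detects (Q : Submodule ℂ (StateSpace F n)) (E : StateSpace F n →ₗ[ℂ] StateSpace F n) : Prop :=
  ∃ c : ℂ, ∀ u ∈ Q, ∀ v ∈ Q, inner ℂ u (E v) = c * inner ℂ u v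

/-- The condition on an error that the minimum distance refers to.  For a code of dimension
different from one it is detectability.  A one-dimensional code detects every operator, and for
it the usual convention is that it must be pure: errors of positive weight have to map the code
into its orthogonal complement. -/
def Handles [DecidableEq F] [Algebra (ZMod p) F] (ζ : ℂ) (Q : Submodule ℂ (StateSpace F n))
    (e : PauliError p F n) : Prop :=
  (Module.finrank ℂ Q ≠ 1 → Detects Q (e.op ζ)) ∧
  (Module.finrank ℂ Q = 1 → 0 < e.weight → ∀ u ∈ Q, ∀ v ∈ Q, inner ℂ u (e.op ζ v) = 0)

/-- `Q` has minimum distance (exactly) `d`: all errors of weight less than `d` are detected, and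
some error of weight `d` is not (with the convention above for one-dimensional codes). -/
def HasMinDistance (p : ℕ) [DecidableEq F] [Algebra (ZMod p) F] (ζ : ℂ)
    (Q : Submodule ℂ (StateSpace F n)) (d : ℕ) : Prop :=
  (∀ e : PauliError p F n, e.weight < d → Handles ζ Q e) ∧
  ∃ e : PauliError p F n, e.weight = d ∧ ¬ Handles ζ Q e

/-- `Q` is an `[[n, k, d]]_q` quantum code: a subspace of `ℂ^(q^n)` of dimension `q^k`, with
minimum distance `d`. -/
def IsQuantumCode (p : ℕ) [DecidableEq F] [Algebra (ZMod p) F] (ζ : ℂ)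
    (Q : Submodule ℂ (StateSpace F n)) (k d : ℕ) : Prop :=
  Module.finrank ℂ Q = Fintype.card F ^ k ∧ HasMinDistance p ζ Q d

/-- `Q` is an `[[n, k, d]]_q` quantum MDS code: it attains the quantum Singleton bound
`2 d ≤ n - k + 2`. -/
def IsQuantumMDSCode (p : ℕ) [DecidableEq F] [Algebra (ZMod p) F] (ζ : ℂ)
    (Q : Submodule ℂ (StateSpace F n)) (k d : ℕ) : Prop :=
  IsQuantumCode p ζ Q k d ∧ 2 * (d : ℤ) = (n : ℤ) - (k : ℤ) + 2

end

end QuantumMDS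

/-! Write `N = m(q-1) = (q²-1)/(2a+1)` and let `K` be the field with `q²` elements. The evaluation
points are the `N`-th roots of unity `x` in `K` with `x^q + x ≠ 0`. Exactly `q-1` of the `N` roots
are excluded, which gives the length `(m-1)(q-1)` (`card_evalPoints`). The weight `x^q + x` lies in
the subfield with `q` elements, so it is a norm `v^(q+1)` with `v ∈ K`.

The Reed–Solomon code with these points and multipliers `v`, of dimension `r = d-1`, is Hermitian
self-orthogonal: its Hermitian products reduce to sums of `(x^q + x) x^(qj+l)` with `j, l < r`. The
weight vanishes at the excluded roots, so these are power sums over all `N`-th roots of unity, which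
are zero because no exponent is divisible by `N` (`sum_evalPoints`). The range of `d` is what makes
this divisibility argument work.

Its Hermitian dual has minimum weight `r+1 = d`. Choosing `γ` with `γ^q = -γ` identifies `K^n` with
`F^n × F^n` and turns the code into an isotropic space `S`, whose joint fixed space under Weyl
operators is the quantum code (`isQuantumCode_stabilizerCode`). The Weyl operators it fails to
detect are those indexed by `S^⊥ \ S`. -/

namespace QuantumMDS

open scoped Matrix
open Polynomial

/-! ### Symplectic form. -/

section Symplectic

variable {F : Type*} [Field F] {n : ℕ}

/-- The symplectic form on `F^n × F^n`. -/
def symp (s t : (Fin n → F) × (Fin n → F)) : F := s.1 ⬝ᵥ t.2 - t.1 ⬝ᵥ s.2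

theorem symp_self (s : (Fin n → F) × (Fin n → F)) : symp s s = 0 := by simp [symp]

theorem symp_neg_left (s t : (Fin n → F) × (Fin n → F)) : symp (-s) t = -symp s t := by
  simp [symp]; ring

theorem symp_smul_left (c : F) (s t : (Fin n → F) × (Fin n → F)) :
    symp (c • s) t = c * symp s t := by
  simp [symp, mul_sub]

end Symplectic

/-! ### Weyl operators and their traces. -/

section Weyl

variable {F : Type*} [Field F] [Fintype F] {n : ℕ}

/-- The symmetrically normalised Weyl operator attached to `(a, b)`. -/
noncomputable def weyl (χ : AddChar F ℂ) (s : (Fin n → F) × (Fin n → F)) :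
    StateSpace F n →ₗ[ℂ] StateSpace F n where
  toFun ψ := WithLp.toLp 2 fun y => χ (s.2 ⬝ᵥ y - s.1 ⬝ᵥ s.2 / 2) * ψ (y - s.1)
  map_add' ψ φ := by
    ext y
    simp [mul_add]
  map_smul' c ψ := by
    ext y
    simp [mul_left_comm]

theorem weyl_apply (χ : AddChar F ℂ) (s : (Fin n → F) × (Fin n → F)) (ψ : StateSpace F n)
    (y : Fin n → F) :
    weyl χ s ψ y = χ (s.2 ⬝ᵥ y - s.1 ⬝ᵥ s.2 / 2) * ψ (y - s.1) := rfl

theorem weyl_zero (χ : AddChar F ℂ) : weyl χ (0 : (Fin n → F) × (Fin n → F)) = LinearMap.id := by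
  ext ψ y
  simp [weyl_apply]

/-- Halving the phase `a · b` makes the cocycle antisymmetric. On an isotropic space it is trivial,
so the operators there form a true representation and no choice of signs is needed. -/
theorem weyl_weyl (h2 : (2 : F) ≠ 0) (χ : AddChar F ℂ) (s t : (Fin n → F) × (Fin n → F))
    (ψ : StateSpace F n) :
    weyl χ s (weyl χ t ψ) = χ (-(symp s t / 2)) • weyl χ (s + t) ψ := by
  ext y
  simp only [weyl_apply, PiLp.smul_apply, smul_eq_mul, ← mul_assoc, ← AddChar.map_add_eq_mul,
    Prod.fst_add, Prod.snd_add, symp, sub_sub]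
  congr 2
  simp only [dotProduct_sub, add_dotProduct, dotProduct_add, dotProduct_comm t.2 s.1]
  field_simp
  ring

theorem weyl_weyl_comm (h2 : (2 : F) ≠ 0) (χ : AddChar F ℂ) (s t : (Fin n → F) × (Fin n → F))
    (ψ : StateSpace F n) :
    weyl χ s (weyl χ t ψ) = χ (-symp s t) • weyl χ t (weyl χ s ψ) := by
  rw [weyl_weyl h2, weyl_weyl h2, smul_smul, ← AddChar.map_add_eq_mul, add_comm t s]
  congr 2
  simp only [symp]
  field_simp
  ring

theorem weyl_neg_weyl (h2 : (2 : F) ≠ 0) (χ : AddChar F ℂ) (s : (Fin n → F) × (Fin n → F))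
    (ψ : StateSpace F n) : weyl χ (-s) (weyl χ s ψ) = ψ := by
  rw [weyl_weyl h2, symp_neg_left, symp_self]
  simp [weyl_zero]

theorem inner_weyl_weyl (χ : AddChar F ℂ) (s : (Fin n → F) × (Fin n → F))
    (u v : StateSpace F n) : inner ℂ (weyl χ s u) (weyl χ s v) = inner ℂ u v := by
  simp only [PiLp.inner_apply, weyl_apply]
  rw [← Equiv.sum_comp (Equiv.subRight s.1) fun y => inner ℂ (u y) (v y)]
  refine Finset.sum_congr rfl fun y _ => ?_
  simp only [RCLike.inner_apply, map_mul, Equiv.subRight_apply, ← AddChar.map_neg_eq_conj]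
  have h (x : F) : χ x * χ (-x) = 1 := by rw [← AddChar.map_add_eq_mul]; simp
  linear_combination (v (y - s.1) * (starRingEnd ℂ) (u (y - s.1))) * h _

theorem inner_weyl_right (h2 : (2 : F) ≠ 0) (χ : AddChar F ℂ) (s : (Fin n → F) × (Fin n → F))
    (u v : StateSpace F n) : inner ℂ u (weyl χ s v) = inner ℂ (weyl χ (-s) u) v := by
  rw [← inner_weyl_weyl χ (-s) u, weyl_neg_weyl h2]

theorem trace_weyl_zero (χ : AddChar F ℂ) :
    LinearMap.trace ℂ _ (weyl χ (0 : (Fin n → F) × (Fin n → F))) = (Fintype.card F : ℂ) ^ n := by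
  rw [weyl_zero, LinearMap.trace_id]
  classical simp

/-- A nonzero shift leaves no diagonal entries. With zero shift the trace is the sum of a nontrivial
character of `F^n`. -/
theorem trace_weyl_of_ne_zero {χ : AddChar F ℂ} (hχ : χ ≠ 1) {s : (Fin n → F) × (Fin n → F)}
    (hs : s ≠ 0) : LinearMap.trace ℂ _ (weyl χ s) = 0 := by
  classical
  rw [LinearMap.trace_eq_sum_inner _ (EuclideanSpace.basisFun (Fin n → F) ℂ)]
  simp only [EuclideanSpace.basisFun_apply, EuclideanSpace.inner_single_left, map_one, one_mul,
    weyl_apply]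
  by_cases ha : s.1 = 0
  · have hb : s.2 ≠ 0 := fun hb => hs (Prod.ext ha hb)
    obtain ⟨i, hi⟩ := Function.ne_iff.mp hb
    let f : (Fin n → F) →+ F := 
      { toFun := fun y => s.2 ⬝ᵥ y, map_zero' := by simp, map_add' := by simp [dotProduct_add] }
    have hne : χ.compAddMonoidHom f ≠ 0 := by
      intro h
      apply hχ
      ext x
      have := DFunLike.congr_fun h (Pi.single i ((s.2 i)⁻¹ * x))
      simpa [f, mul_inv_cancel_left₀ hi] using this
    have := AddChar.sum_eq_zero_iff_ne_zero.mpr hne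
    simpa [ha, f] using this
  · refine Finset.sum_eq_zero fun y _ => ?_
    simp [ha]

end Weyl

/-! ### Stabilizer codes: dimension and detection. -/

section Stabilizer

variable {F : Type*} [Field F] [Fintype F] {n : ℕ}

/-- The stabilizer code of `S`: the vectors fixed by the Weyl operators of all elements of `S`. -/
def stabilizerCode (χ : AddChar F ℂ) (S : Submodule F ((Fin n → F) × (Fin n → F))) :
    Submodule ℂ (StateSpace F n) where
  carrier := {ψ | ∀ s ∈ S, weyl χ s ψ = ψ}
  add_mem' hu hv s hs := by rw [map_add, hu s hs, hv s hs]
  zero_mem' s _ := map_zero _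
  smul_mem' c u hu s hs := by rw [map_smul, hu s hs]

/-- The average of the Weyl operators of the elements of `S`. -/
noncomputable def stabilizerProj (χ : AddChar F ℂ)
    (S : Submodule F ((Fin n → F) × (Fin n → F))) : StateSpace F n →ₗ[ℂ] StateSpace F n :=
  (Nat.card S : ℂ)⁻¹ • ∑ᶠ s : S, weyl χ (s : (Fin n → F) × (Fin n → F))

variable {χ : AddChar F ℂ} {S : Submodule F ((Fin n → F) × (Fin n → F))}

theorem weyl_weyl_of_isotropic (h2 : (2 : F) ≠ 0) (hS : ∀ s ∈ S, ∀ t ∈ S, symp s t = 0)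
    {s t : (Fin n → F) × (Fin n → F)} (hs : s ∈ S) (ht : t ∈ S) (ψ : StateSpace F n) :
    weyl χ s (weyl χ t ψ) = weyl χ (s + t) ψ := by
  rw [weyl_weyl h2, hS s hs t ht]
  simp

theorem stabilizerProj_isProj (h2 : (2 : F) ≠ 0) (hS : ∀ s ∈ S, ∀ t ∈ S, symp s t = 0) :
    LinearMap.IsProj (stabilizerCode χ S) (stabilizerProj χ S) := by
  classical
  have := Fintype.ofFinite S
  constructor
  · intro ψ s hs
    simp only [stabilizerProj, finsum_eq_sum_of_fintype, LinearMap.smul_apply, map_smul,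
      LinearMap.sum_apply, map_sum]
    congr 1
    rw [← Equiv.sum_comp (Equiv.addLeft (⟨s, hs⟩ : S)) fun t : S => weyl χ (t : _ × _) ψ]
    exact Finset.sum_congr rfl fun t _ => weyl_weyl_of_isotropic h2 hS hs t.2 ψ
  · intro ψ hψ
    have h : ∀ s : S, weyl χ (s : _ × _) ψ = ψ := fun s => hψ s s.2
    have hc : (Fintype.card S : ℂ) ≠ 0 := by simp
    simp only [stabilizerProj, finsum_eq_sum_of_fintype, LinearMap.smul_apply,
      LinearMap.sum_apply, h, Nat.card_eq_fintype_card, Finset.sum_const, Finset.card_univ]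
    rw [← Nat.cast_smul_eq_nsmul ℂ, smul_smul, inv_mul_cancel₀ hc, one_smul]

/-- The rank of a projection is its trace, and in the averaged sum only the identity has nonzero
trace. -/
theorem card_mul_finrank_stabilizerCode (h2 : (2 : F) ≠ 0) (hχ : χ ≠ 1)
    (hS : ∀ s ∈ S, ∀ t ∈ S, symp s t = 0) :
    Nat.card S * Module.finrank ℂ (stabilizerCode χ S) = Fintype.card F ^ n := by
  classical
  have := Fintype.ofFinite S
  have hc : (Fintype.card S : ℂ) ≠ 0 := by simp
  have h := (stabilizerProj_isProj (χ := χ) h2 hS).trace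
  simp only [stabilizerProj, finsum_eq_sum_of_fintype, map_smul, map_sum,
    Nat.card_eq_fintype_card, smul_eq_mul] at h
  rw [Finset.sum_eq_single_of_mem (0 : S) (Finset.mem_univ _)
    fun s _ hs => trace_weyl_of_ne_zero hχ (by simpa using hs)] at h
  rw [Submodule.coe_zero, trace_weyl_zero] at h
  rw [Nat.card_eq_fintype_card]
  have : (Fintype.card S * Module.finrank ℂ (stabilizerCode χ S) : ℂ) = Fintype.card F ^ n := by
    rw [← h, mul_inv_cancel_left₀ hc]
  exact_mod_cast this

theorem weyl_mem_stabilizerCode (h2 : (2 : F) ≠ 0) {z : (Fin n → F) × (Fin n → F)}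
    (hz : ∀ s ∈ S, symp s z = 0) {ψ : StateSpace F n} (hψ : ψ ∈ stabilizerCode χ S) :
    weyl χ z ψ ∈ stabilizerCode χ S := by
  intro s hs
  rw [weyl_weyl_comm h2, hz s hs, hψ s hs]
  simp

theorem inner_weyl_eq_zero (h2 : (2 : F) ≠ 0) (hχ : χ ≠ 1) {s z : (Fin n → F) × (Fin n → F)}
    (hs : s ∈ S) (hz : symp s z ≠ 0) {u v : StateSpace F n}
    (hu : u ∈ stabilizerCode χ S) (hv : v ∈ stabilizerCode χ S) :
    inner ℂ u (weyl χ z v) = 0 := by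
  obtain ⟨x, hx⟩ := DFunLike.ne_iff.mp hχ
  -- Scaled so that moving `weyl χ (c • s)` past `weyl χ z` costs the factor `χ x ≠ 1`.
  set c := -(x * (symp s z)⁻¹)
  have hcs : c • s ∈ S := S.smul_mem c hs
  have h : weyl χ (c • s) (weyl χ z v) = χ x • weyl χ z v := by
    rw [weyl_weyl_comm h2, hv _ hcs, symp_smul_left]
    simp [c, inv_mul_cancel_right₀ hz]
  have h' : inner ℂ u (weyl χ z v) = χ x * inner ℂ u (weyl χ z v) := by
    rw [← inner_smul_right, ← h, inner_weyl_right h2 χ (c • s) u, hu _ (S.neg_mem hcs)]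
  have h1 : χ x - 1 ≠ 0 := sub_ne_zero.mpr (by simpa using hx)
  have : (χ x - 1) * inner ℂ u (weyl χ z v) = 0 := by linear_combination -h'
  exact (mul_eq_zero.mp this).resolve_left h1

/-- Here `weyl χ z` preserves the code, so detection would make it the scalar `c` there. Its product
with the projection has trace zero, since `z + s ≠ 0` for every `s ∈ S`. This forces `c = 0`,
against invertibility. -/
theorem not_detects_weyl (h2 : (2 : F) ≠ 0) (hχ : χ ≠ 1)
    (hS : ∀ s ∈ S, ∀ t ∈ S, symp s t = 0) {z : (Fin n → F) × (Fin n → F)}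
    (hz : ∀ s ∈ S, symp s z = 0) (hzS : z ∉ S) (hQ : stabilizerCode χ S ≠ ⊥) {c : ℂ}
    (h : ∀ u ∈ stabilizerCode χ S, ∀ v ∈ stabilizerCode χ S,
      inner ℂ u (weyl χ z v) = c * inner ℂ u v) : False := by
  classical
  have := Fintype.ofFinite S
  have hP := stabilizerProj_isProj (χ := χ) h2 hS
  have hW : ∀ v ∈ stabilizerCode χ S, weyl χ z v = c • v := by
    intro v hv
    have hmem : weyl χ z v - c • v ∈ stabilizerCode χ S :=
      sub_mem (weyl_mem_stabilizerCode h2 hz hv) (Submodule.smul_mem _ _ hv)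
    -- The difference lies in the code and is orthogonal to it.
    have h0 : inner ℂ (weyl χ z v - c • v) (weyl χ z v - c • v) = 0 := by
      rw [inner_sub_right, h _ hmem v hv, inner_smul_right, sub_self]
    exact sub_eq_zero.mp (inner_self_eq_zero.mp h0)
  have hcomp : weyl χ z ∘ₗ stabilizerProj χ S = c • stabilizerProj χ S := by
    ext1 ψ
    exact hW _ (hP.map_mem ψ)
  have htr := congrArg (LinearMap.trace ℂ _) hcomp
  have hl : LinearMap.trace ℂ _ (weyl χ z ∘ₗ stabilizerProj χ S) = 0 := by
    have hsum : weyl χ z ∘ₗ ∑ s : S, weyl χ (s : _ × _) =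
        ∑ s : S, weyl χ z ∘ₗ weyl χ (s : _ × _) := by
      ext1 ψ
      simp
    simp only [stabilizerProj, finsum_eq_sum_of_fintype, LinearMap.comp_smul, map_smul, hsum,
      map_sum]
    rw [Finset.sum_eq_zero, smul_zero]
    intro s _
    have : weyl χ z ∘ₗ weyl χ (s : _ × _) = χ (-(symp z s / 2)) • weyl χ (z + s.1) := by
      ext1 ψ
      exact weyl_weyl h2 χ z s ψ
    rw [this, map_smul, trace_weyl_of_ne_zero hχ, smul_zero]
    intro h0
    exact hzS (eq_neg_of_add_eq_zero_left h0 ▸ S.neg_mem s.2)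
  rw [hl, map_smul, hP.trace, smul_eq_mul, eq_comm, mul_eq_zero] at htr
  obtain ⟨v, hv, hv0⟩ := (Submodule.ne_bot_iff _).mp hQ
  rcases htr with h0 | h0
  · apply hv0
    rw [← weyl_neg_weyl h2 χ z v, hW v hv, h0, zero_smul, map_zero]
  · exact hQ (Submodule.finrank_eq_zero.mp (by exact_mod_cast h0))

end Stabilizer

/-! ### From symplectic data to quantum codes. -/

section Code

variable {p : ℕ} {F : Type*} [Field F] [Fintype F] {n : ℕ}

/-- The additive character `x ↦ ζ ^ Tr x`. -/
noncomputable def traceChar [NeZero p] [Algebra (ZMod p) F] {ζ : ℂ} (hζ : IsPrimitiveRoot ζ p) :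
    AddChar F ℂ :=
  (AddChar.zmodChar p hζ.pow_eq_one).compAddMonoidHom
    (Algebra.trace (ZMod p) F).toAddMonoidHom

omit [Fintype F] in
theorem traceChar_apply [NeZero p] [Algebra (ZMod p) F] {ζ : ℂ} (hζ : IsPrimitiveRoot ζ p)
    (x : F) : traceChar hζ x = ζ ^ (Algebra.trace (ZMod p) F x).val := rfl

theorem traceChar_ne_one [Fact p.Prime] [Algebra (ZMod p) F] {ζ : ℂ}
    (hζ : IsPrimitiveRoot ζ p) : traceChar (F := F) hζ ≠ 1 := by
  intro h
  obtain ⟨x, hx⟩ := Algebra.trace_surjective (ZMod p) F 1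
  have h1 := DFunLike.congr_fun h x
  rw [traceChar_apply, hx, ZMod.val_one] at h1
  exact hζ.ne_one (Fact.out : p.Prime).one_lt (by simpa using h1)

theorem PauliError.op_eq_weyl [Fact p.Prime] [Algebra (ZMod p) F] {ζ : ℂ}
    (hζ : IsPrimitiveRoot ζ p) (h2 : (2 : F) ≠ 0) (e : PauliError p F n) :
    e.op ζ = (ζ ^ (e.phase : ℕ) * traceChar hζ (-(e.shift ⬝ᵥ e.clock / 2))) •
      weyl (traceChar hζ) (e.shift, e.clock) := by
  ext ψ y
  change ζ ^ ((e.phase : ℕ) + (Algebra.trace (ZMod p) F (∑ i, e.clock i * (y i - e.shift i))).val)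
      * ψ (y - e.shift) = _ * (traceChar hζ (e.clock ⬝ᵥ y - e.shift ⬝ᵥ e.clock / 2)
      * ψ (y - e.shift))
  rw [pow_add, ← traceChar_apply hζ, ← mul_assoc, mul_assoc (ζ ^ _) (traceChar hζ (-_)),
    ← AddChar.map_add_eq_mul]
  congr 3
  change e.clock ⬝ᵥ (y - e.shift) = _
  rw [dotProduct_sub, dotProduct_comm e.clock e.shift]
  field_simp
  ring

theorem isQuantumCode_stabilizerCode [Fact p.Prime] [DecidableEq F] [Algebra (ZMod p) F] {ζ : ℂ}
    (hζ : IsPrimitiveRoot ζ p) (h2 : (2 : F) ≠ 0) {S : Submodule F ((Fin n → F) × (Fin n → F))}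
    (hS : ∀ s ∈ S, ∀ t ∈ S, symp s t = 0) {k d : ℕ} (hd : 0 < d)
    (hcard : Nat.card S * Fintype.card F ^ k = Fintype.card F ^ n)
    (hpure : ∀ z : (Fin n → F) × (Fin n → F), (∀ s ∈ S, symp s z = 0) →
      (Finset.univ.filter fun i => (z.1 i, z.2 i) ≠ (0, 0)).card < d → z = 0)
    (hdist : ∃ z : (Fin n → F) × (Fin n → F), (∀ s ∈ S, symp s z = 0) ∧ (k ≠ 0 → z ∉ S) ∧
      (Finset.univ.filter fun i => (z.1 i, z.2 i) ≠ (0, 0)).card = d) :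
    IsQuantumCode p ζ (stabilizerCode (traceChar hζ) S) k d := by
  have hχ := traceChar_ne_one (F := F) hζ
  have hζ0 : ζ ≠ 0 := hζ.ne_zero (Fact.out : p.Prime).ne_zero
  have hrank : Module.finrank ℂ (stabilizerCode (traceChar hζ) S) = Fintype.card F ^ k := by
    apply Nat.eq_of_mul_eq_mul_left (Nat.card_pos (α := S))
    rw [hcard, card_mul_finrank_stabilizerCode h2 hχ hS]
  have hq : 1 < Fintype.card F := Fintype.one_lt_card
  have hbot : stabilizerCode (traceChar hζ) S ≠ ⊥ := by
    intro h
    rw [h, finrank_bot] at hrank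
    exact (pow_pos (by omega : 0 < Fintype.card F) k).ne hrank
  refine ⟨hrank, fun e he => ?_, ?_⟩
  · have key : (e.shift, e.clock) ≠ (0 : (Fin n → F) × (Fin n → F)) →
        ∀ u ∈ stabilizerCode (traceChar hζ) S, ∀ v ∈ stabilizerCode (traceChar hζ) S,
          inner ℂ u (e.op ζ v) = 0 := by
      intro hne u hu v hv
      have : ¬ ∀ s ∈ S, symp s (e.shift, e.clock) = 0 := fun h => hne (hpure _ h he)
      push Not at this
      obtain ⟨s, hs, hse⟩ := this
      rw [e.op_eq_weyl hζ h2, LinearMap.smul_apply, inner_smul_right,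
        inner_weyl_eq_zero h2 hχ hs hse hu hv, mul_zero]
    refine ⟨fun _ => ?_, fun _ hw => key fun h0 => ?_⟩
    · by_cases hne : (e.shift, e.clock) = (0 : (Fin n → F) × (Fin n → F))
      · rw [e.op_eq_weyl hζ h2, hne, weyl_zero]
        exact ⟨_, fun u _ v _ => by rw [LinearMap.smul_apply, inner_smul_right]; rfl⟩
      · exact ⟨0, fun u hu v hv => by rw [key hne u hu v hv, zero_mul]⟩
    · have h1 : e.shift = 0 := congrArg Prod.fst h0
      have h2 : e.clock = 0 := congrArg Prod.snd h0
      simp [PauliError.weight, h1, h2] at hw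
  · obtain ⟨z, hz, hzS, hzd⟩ := hdist
    let e : PauliError p F n := ⟨⟨0, (Fact.out : p.Prime).pos⟩, z.1, z.2⟩
    have hop := e.op_eq_weyl hζ h2
    have hc : ζ ^ (e.phase : ℕ) * traceChar hζ (-(e.shift ⬝ᵥ e.clock / 2)) ≠ 0 := by
      rw [traceChar_apply]
      exact mul_ne_zero (pow_ne_zero _ hζ0) (pow_ne_zero _ hζ0)
    generalize ζ ^ (e.phase : ℕ) * traceChar hζ (-(e.shift ⬝ᵥ e.clock / 2)) = c at hop hc
    change e.op ζ = c • weyl (traceChar hζ) z at hop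
    refine ⟨e, hzd, fun hH => ?_⟩
    by_cases h1 : Module.finrank ℂ (stabilizerCode (traceChar hζ) S) = 1
    -- For a one-dimensional code `z` may lie in `S`. Purity fails with `u = weyl z v`, whose inner
    -- product with `weyl z v` is that of `v` with itself.
    · have h0 := hH.2 h1 (hd.trans_eq hzd.symm)
      obtain ⟨v, hv, hv0⟩ := (Submodule.ne_bot_iff _).mp hbot
      have h3 := h0 _ (weyl_mem_stabilizerCode h2 hz hv) v hv
      rw [hop, LinearMap.smul_apply, inner_smul_right, inner_weyl_weyl] at h3
      exact hv0 (inner_self_eq_zero.mp ((mul_eq_zero.mp h3).resolve_left hc))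
    · obtain ⟨c', hc'⟩ := hH.1 h1
      have hk : k ≠ 0 := by
        rintro rfl
        exact h1 (by simpa using hrank)
      refine not_detects_weyl (c := c⁻¹ * c') h2 hχ hS hz (hzS hk) hbot fun u hu v hv => ?_
      have := hc' u hu v hv
      rw [hop, LinearMap.smul_apply, inner_smul_right] at this
      rw [mul_assoc, ← this, inv_mul_cancel_left₀ hc]

end Code

/-! ### The Hermitian form and its symplectic part. -/

section Hermitian

variable {F K : Type*} [Field F] [Fintype F] [Field K] [Fintype K] [Algebra F K] {n : ℕ}

/-- The Hermitian form `∑ uᵢ wᵢ^q` on `K^n`. -/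
def herm (q : ℕ) (u w : Fin n → K) : K := ∑ i, u i * w i ^ q

omit [Fintype K] in
variable (F) in
theorem add_pow_card_field (x y : K) :
    (x + y) ^ Fintype.card F = x ^ Fintype.card F + y ^ Fintype.card F :=
  map_add (FiniteField.frobeniusAlgHom F K) x y

omit [Fintype K] in
variable (F) in
theorem sum_pow_card_field {ι : Type*} (s : Finset ι) (f : ι → K) :
    (∑ i ∈ s, f i) ^ Fintype.card F = ∑ i ∈ s, f i ^ Fintype.card F :=
  map_sum (FiniteField.frobeniusAlgHom F K) f s

omit [Fintype K] in
theorem algebraMap_pow_card_field (x : F) :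
    algebraMap F K x ^ Fintype.card F = algebraMap F K x := by
  rw [← map_pow, FiniteField.pow_card]

omit [Field F] [Algebra F K] in
theorem pow_card_pow_card (hK : Fintype.card K = Fintype.card F ^ 2) (x : K) :
    (x ^ Fintype.card F) ^ Fintype.card F = x := by
  rw [← pow_mul, ← sq, ← hK, FiniteField.pow_card]

-- For a generator `g` of `Kˣ` take `γ = g^((q+1)/2)`; then `γ^(q-1) = g^((q²-1)/2) = -1`.
omit [Field F] [Algebra F K] in
theorem exists_pow_card_eq_neg (hodd : Odd (Fintype.card F))
    (hK : Fintype.card K = Fintype.card F ^ 2) :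
    ∃ γ : K, γ ≠ 0 ∧ γ ^ Fintype.card F = -γ := by
  obtain ⟨g, hg⟩ := IsCyclic.exists_generator (α := Kˣ)
  obtain ⟨t, ht⟩ := hodd
  have hord : orderOf g = Fintype.card F ^ 2 - 1 := by
    rw [orderOf_eq_card_of_forall_mem_zpowers hg, Nat.card_units, Nat.card_eq_fintype_card, hK]
  have hp : IsPrimitiveRoot (g : K) ((2 * t) * (2 * (t + 1))) := by
    rw [IsPrimitiveRoot.coe_units_iff]
    have : (2 * t) * (2 * (t + 1)) = orderOf g := by
      rw [hord, ht]
      have : (2 * t + 1) ^ 2 = (2 * t) * (2 * (t + 1)) + 1 := by ring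
      omega
    rw [this]
    exact IsPrimitiveRoot.orderOf g
  have hq : 1 < Fintype.card K := Fintype.one_lt_card
  have ht0 : 0 < t := by
    rcases Nat.eq_zero_or_pos t with rfl | h
    · rw [hK, ht] at hq
      simp at hq
    · exact h
  have h2 : IsPrimitiveRoot (((g : K) ^ (t + 1)) ^ (2 * t)) 2 := by
    rw [← pow_mul]
    exact hp.pow (by positivity) (by ring)
  refine ⟨(g : K) ^ (t + 1), pow_ne_zero _ g.ne_zero, ?_⟩
  rw [ht, pow_succ, h2.eq_neg_one_of_two_right, neg_one_mul]

/-- The `F`-linear map `(a, b) ↦ a + γ b`. -/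
def combine (γ : K) : ((Fin n → F) × (Fin n → F)) →ₗ[F] (Fin n → K) where
  toFun s i := algebraMap F K (s.1 i) + γ * algebraMap F K (s.2 i)
  map_add' s t := by
    ext i
    simp
    ring
  map_smul' c s := by
    ext i
    simp [Algebra.smul_def]
    ring

omit [Fintype F] [Fintype K] in
theorem combine_apply (γ : K) (s : (Fin n → F) × (Fin n → F)) (i : Fin n) :
    combine γ s i = algebraMap F K (s.1 i) + γ * algebraMap F K (s.2 i) := rfl

variable {γ : K}

omit [Fintype K] in
theorem combine_eq_zero_iff (h2 : (2 : K) ≠ 0) (hγ0 : γ ≠ 0) (hγ : γ ^ Fintype.card F = -γ)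
    (a b : F) : algebraMap F K a + γ * algebraMap F K b = 0 ↔ a = 0 ∧ b = 0 := by
  refine ⟨fun h => ?_, fun h => by simp [h.1, h.2]⟩
  have h' := congrArg (· ^ Fintype.card F) h
  simp only [add_pow_card_field F, mul_pow, algebraMap_pow_card_field, hγ] at h'
  rw [zero_pow Fintype.card_ne_zero] at h'
  have ha : 2 * algebraMap F K a = 0 := by linear_combination h + h'
  have ha : a = 0 := by simpa [h2] using ha
  subst ha
  simpa [hγ0] using h

theorem combine_bijective (hK : Fintype.card K = Fintype.card F ^ 2) (h2 : (2 : K) ≠ 0)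
    (hγ0 : γ ≠ 0) (hγ : γ ^ Fintype.card F = -γ) :
    Function.Bijective (combine (F := F) (n := n) γ) := by
  classical
  rw [Fintype.bijective_iff_injective_and_card]
  refine ⟨(injective_iff_map_eq_zero _).mpr fun s hs => ?_, ?_⟩
  · have h : ∀ i, s.1 i = 0 ∧ s.2 i = 0 := fun i =>
      (combine_eq_zero_iff h2 hγ0 hγ _ _).mp (congrFun hs i)
    exact Prod.ext (funext fun i => (h i).1) (funext fun i => (h i).2)
  · simp [hK]
    ring

-- Since `γ²` is fixed by the `q`-Frobenius, this splits the form into a fixed part and a part that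
-- changes sign; the latter carries the symplectic form.
omit [Fintype K] in
theorem herm_combine (hγ : γ ^ Fintype.card F = -γ) (s t : (Fin n → F) × (Fin n → F)) :
    herm (Fintype.card F) (combine γ s) (combine γ t) =
      (algebraMap F K (s.1 ⬝ᵥ t.1) - γ ^ 2 * algebraMap F K (s.2 ⬝ᵥ t.2)) -
        γ * algebraMap F K (symp s t) := by
  simp only [herm, combine_apply, add_pow_card_field F, mul_pow, algebraMap_pow_card_field, hγ,
    symp, dotProduct, map_sub, map_sum, map_mul, Finset.mul_sum, ← Finset.sum_sub_distrib]
  refine Finset.sum_congr rfl fun i _ => ?_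
  ring

end Hermitian

/-! ### Quantum codes from Hermitian self-orthogonal codes. -/

section HermitianCode

variable {F K : Type*} [Field F] [Fintype F] [Field K] [Fintype K] [Algebra F K] {n : ℕ} {γ : K}

omit [Fintype K] in
theorem symp_eq_zero_of_herm_eq_zero (h2 : (2 : K) ≠ 0) (hγ0 : γ ≠ 0)
    (hγ : γ ^ Fintype.card F = -γ) {s t : (Fin n → F) × (Fin n → F)}
    (h : herm (Fintype.card F) (combine γ s) (combine γ t) = 0) : symp s t = 0 := by
  rw [herm_combine hγ] at h
  have h' := congrArg (FiniteField.frobeniusAlgHom F K) h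
  simp only [map_sub, map_mul, map_pow, AlgHom.commutes, map_zero] at h'
  rw [FiniteField.frobeniusAlgHom_apply, hγ] at h'
  have h3 : 2 * (γ * algebraMap F K (symp s t)) = 0 := by linear_combination h' - h
  simpa [h2, hγ0] using h3

omit [Fintype F] [Fintype K] in
theorem herm_smul_left {q : ℕ} (c : K) (u w : Fin n → K) : herm q (c • u) w = c * herm q u w := by
  simp [herm, Finset.mul_sum, mul_assoc]

-- Vanishing symplectic products make both `h` and `γ h` fixed by Frobenius, where `h` is the
-- Hermitian product; as `γ^q = -γ`, this forces `h = 0`. Hence for a `K`-linear code the symplectic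
-- and Hermitian duals agree.
omit [Fintype K] in
theorem herm_eq_zero_of_symp_eq_zero (h2 : (2 : K) ≠ 0) (hγ0 : γ ≠ 0)
    (hγ : γ ^ Fintype.card F = -γ) {s s' t : (Fin n → F) × (Fin n → F)}
    (hs : combine γ s' = γ • combine γ s) (h : symp s t = 0) (h' : symp s' t = 0) :
    herm (Fintype.card F) (combine γ s) (combine γ t) = 0 := by
  have hfix : ∀ r : (Fin n → F) × (Fin n → F), symp r t = 0 →
      herm (Fintype.card F) (combine γ r) (combine γ t) ^ Fintype.card F =
        herm (Fintype.card F) (combine γ r) (combine γ t) := by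
    intro r hr
    rw [herm_combine hγ, hr, ← FiniteField.frobeniusAlgHom_apply F K]
    simp only [map_sub, map_mul, map_pow, AlgHom.commutes, map_zero]
    rw [FiniteField.frobeniusAlgHom_apply, hγ]
    ring
  have h1 := hfix s h
  have h3 := hfix s' h'
  rw [hs, herm_smul_left, mul_pow, h1, hγ] at h3
  have h4 : 2 * (γ * herm (Fintype.card F) (combine γ s) (combine γ t)) = 0 := by
    linear_combination -h3
  simpa [h2, hγ0] using h4

theorem exists_isQuantumCode_of_herm {p : ℕ} [Fact p.Prime] [DecidableEq F] [DecidableEq K]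
    [Algebra (ZMod p) F]
    {ζ : ℂ} (hζ : IsPrimitiveRoot ζ p) (hodd : Odd (Fintype.card F))
    (hK : Fintype.card K = Fintype.card F ^ 2) (h2 : (2 : F) ≠ 0)
    (C : Submodule K (Fin n → K))
    (hself : ∀ u ∈ C, ∀ w ∈ C, herm (Fintype.card F) u w = 0) {k d : ℕ} (hd : 0 < d)
    (hn : 2 * Module.finrank K C + k = n)
    (hpure : ∀ w : Fin n → K, (∀ u ∈ C, herm (Fintype.card F) u w = 0) →
      (Finset.univ.filter fun i => w i ≠ 0).card < d → w = 0)
    (hdist : ∃ w : Fin n → K, (∀ u ∈ C, herm (Fintype.card F) u w = 0) ∧ (k ≠ 0 → w ∉ C) ∧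
      (Finset.univ.filter fun i => w i ≠ 0).card = d) :
    ∃ Q : Submodule ℂ (StateSpace F n), IsQuantumCode p ζ Q k d := by
  obtain ⟨γ, hγ0, hγ⟩ := exists_pow_card_eq_neg (F := F) (K := K) hodd hK
  have h2K : (2 : K) ≠ 0 := by
    rw [← map_ofNat (algebraMap F K) 2]
    exact (_root_.map_ne_zero _).mpr h2
  have hbij := combine_bijective (F := F) (n := n) hK h2K hγ0 hγ
  let S : Submodule F ((Fin n → F) × (Fin n → F)) := (C.restrictScalars F).comap (combine γ)
  have horth : ∀ z, (∀ s ∈ S, symp s z = 0) →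
      ∀ u ∈ C, herm (Fintype.card F) u (combine γ z) = 0 := by
    intro z hz u hu
    obtain ⟨s, rfl⟩ := hbij.2 u
    obtain ⟨s', hs'⟩ := hbij.2 (γ • combine γ s)
    refine herm_eq_zero_of_symp_eq_zero h2K hγ0 hγ hs' (hz s hu) (hz s' ?_)
    change combine γ s' ∈ C
    rw [hs']
    exact C.smul_mem γ hu
  have hwt : ∀ z : (Fin n → F) × (Fin n → F),
      (Finset.univ.filter fun i => (z.1 i, z.2 i) ≠ (0, 0)) =
        Finset.univ.filter fun i => combine γ z i ≠ 0 := by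
    intro z
    refine Finset.filter_congr fun i _ => not_congr ?_
    rw [combine_apply, combine_eq_zero_iff h2K hγ0 hγ, Prod.mk.injEq]
  have hcard : Nat.card S = (Fintype.card F ^ 2) ^ Module.finrank K C := by
    have e : S ≃ C := (Equiv.ofBijective _ hbij).subtypeEquiv fun s => Iff.rfl
    rw [Nat.card_congr e, Module.natCard_eq_pow_finrank (K := K), Nat.card_eq_fintype_card, hK]
  refine ⟨_, isQuantumCode_stabilizerCode hζ h2 (S := S) (fun s hs t ht =>
    symp_eq_zero_of_herm_eq_zero h2K hγ0 hγ (hself _ hs _ ht)) hd ?_ ?_ ?_⟩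
  · rw [hcard, ← pow_mul, ← pow_add, hn]
  · intro z hz hzd
    rw [hwt] at hzd
    exact hbij.1 ((hpure _ (horth z hz) hzd).trans (map_zero _).symm)
  · obtain ⟨w, hw, hwC, hwd⟩ := hdist
    obtain ⟨z, rfl⟩ := hbij.2 w
    refine ⟨z, fun s hs => symp_eq_zero_of_herm_eq_zero h2K hγ0 hγ (hw _ hs), hwC, ?_⟩
    rw [hwt, hwd]

end HermitianCode

/-! ### Generalized Reed–Solomon codes and their duals. -/

section ReedSolomon

variable {K : Type*} [Field K] {n : ℕ}

/-- The encoder of a generalized Reed–Solomon code. -/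
noncomputable def grsEncode (v y : Fin n → K) (r : ℕ) : degreeLT K r →ₗ[K] (Fin n → K) where
  toFun f i := v i * (f : K[X]).eval (y i)
  map_add' f g := by
    ext i
    simp [mul_add]
  map_smul' c f := by
    ext i
    simp [mul_left_comm]

theorem grsEncode_apply (v y : Fin n → K) (r : ℕ) (f : degreeLT K r) (i : Fin n) :
    grsEncode v y r f i = v i * (f : K[X]).eval (y i) := rfl

theorem finrank_degreeLT (r : ℕ) : Module.finrank K (degreeLT K r) = r := by
  rw [(degreeLTEquiv K r).finrank_eq, Module.finrank_fin_fun]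

variable [DecidableEq K] {v y : Fin n → K} {r : ℕ}

theorem eq_zero_of_card_zeros (hv : ∀ i, v i ≠ 0) (hy : Function.Injective y) (f : degreeLT K r)
    (h : r ≤ (Finset.univ.filter fun i => grsEncode v y r f i = 0).card) : f = 0 := by
  apply Subtype.ext
  refine eq_zero_of_degree_lt_of_eval_index_eq_zero (v := y) _ hy.injOn
    ((mem_degreeLT.mp f.2).trans_le (by exact_mod_cast h)) fun i hi => ?_
  have := (Finset.mem_filter.mp hi).2
  rw [grsEncode_apply] at this
  exact (mul_eq_zero.mp this).resolve_left (hv i)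

theorem grsEncode_injective (hv : ∀ i, v i ≠ 0) (hy : Function.Injective y) (hr : r ≤ n) :
    Function.Injective (grsEncode v y r) := by
  refine (injective_iff_map_eq_zero _).mpr fun f hf => eq_zero_of_card_zeros hv hy f ?_
  simpa [hf] using hr

theorem eq_zero_of_sum_mul_eval_eq_zero (hy : Function.Injective y) (g : Fin n → K)
    (h : ∀ f ∈ degreeLT K r, ∑ i, g i * f.eval (y i) = 0)
    (hcard : (Finset.univ.filter fun i => g i ≠ 0).card ≤ r) : g = 0 := by
  by_contra hne
  obtain ⟨i, hi⟩ := Function.ne_iff.mp hne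
  set T := Finset.univ.filter fun i => g i ≠ 0 with hT
  have hiT : i ∈ T := by simpa [hT] using hi
  -- Of degree `|T| - 1 < r`, it vanishes on the support of `g` except at `i`, and so isolates `g
  -- i`.
  let f : K[X] := ∏ t ∈ T.erase i, (X - C (y t))
  have hf : f ∈ degreeLT K r := by
    rw [mem_degreeLT, degree_prod]
    simp only [degree_X_sub_C, Finset.sum_const, nsmul_eq_mul, mul_one]
    have := Finset.card_erase_lt_of_mem hiT
    exact_mod_cast this.trans_le hcard
  have h0 := h f hf
  rw [Finset.sum_eq_single_of_mem i (Finset.mem_univ i)] at h0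
  · refine (mul_ne_zero hi ?_) h0
    simp only [f, eval_prod, eval_sub, eval_X, eval_C]
    exact Finset.prod_ne_zero_iff.mpr fun t ht =>
      sub_ne_zero.mpr fun h => (Finset.mem_erase.mp ht).1 (hy h).symm
  · intro j _ hji
    by_cases hj : g j = 0
    · simp [hj]
    · have : f.eval (y j) = 0 := by
        simp only [f, eval_prod, eval_sub, eval_X, eval_C]
        exact Finset.prod_eq_zero (i := j) (by simp [hT, hji, hj]) (sub_self _)
      simp [this]

/-- On the first `r+1` coordinates there are `r` Vandermonde equations, hence a nonzero solution.
The preceding bound excludes smaller support. -/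
theorem exists_sum_mul_eval_eq_zero (hy : Function.Injective y) (hr : r + 1 ≤ n) :
    ∃ g : Fin n → K, (∀ f ∈ degreeLT K r, ∑ i, g i * f.eval (y i) = 0) ∧
      (Finset.univ.filter fun i => g i ≠ 0).card = r + 1 := by
  let L : (Fin (r + 1) → K) →ₗ[K] (Fin r → K) :=
    Matrix.mulVecLin (Matrix.of fun (j : Fin r) (i : Fin (r + 1)) =>
      y (Fin.castLE hr i) ^ (j : ℕ))
  have hL : LinearMap.ker L ≠ ⊥ := LinearMap.ker_ne_bot_of_finrank_lt (by simp)
  obtain ⟨g, hg, hg0⟩ := (Submodule.ne_bot_iff _).mp hL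
  let g' : Fin n → K := Function.extend (Fin.castLE hr) g 0
  have hinj : Function.Injective (Fin.castLE hr) := Fin.castLE_injective hr
  have hsum : ∀ h : Fin n → K, ∑ i, g' i * h i = ∑ i, g i * h (Fin.castLE hr i) := by
    intro h
    symm
    refine Fintype.sum_of_injective _ hinj _ _ (fun i hi => ?_) fun i => ?_
    · simp only [g']
      rw [Function.extend_apply' _ _ _ hi]
      simp
    · simp only [g']
      rw [hinj.extend_apply]
  have horth : ∀ f ∈ degreeLT K r, ∑ i, g' i * f.eval (y i) = 0 := by
    intro f hf
    rw [hsum fun i => f.eval (y i)]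
    simp only [eval_eq_sum_degreeLTEquiv hf, Finset.mul_sum]
    rw [Finset.sum_comm]
    refine Finset.sum_eq_zero fun j _ => ?_
    have hj := congrFun (LinearMap.mem_ker.mp hg) j
    simp only [L, Matrix.mulVecLin_apply, Matrix.mulVec, dotProduct, Matrix.of_apply,
      Pi.zero_apply] at hj
    rw [← mul_zero (degreeLTEquiv K r ⟨f, hf⟩ j), ← hj, Finset.mul_sum]
    exact Finset.sum_congr rfl fun i _ => by ring
  refine ⟨g', horth, le_antisymm ?_ ?_⟩
  · have hsub : (Finset.univ.filter fun i => g' i ≠ 0) ⊆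
        Finset.univ.image (Fin.castLE hr) := by
      intro i hi
      by_contra hni
      refine (Finset.mem_filter.mp hi).2 ?_
      simp only [g']
      rw [Function.extend_apply' _ _ _ (by simpa using hni)]
      rfl
    refine (Finset.card_le_card hsub).trans (Finset.card_image_le.trans ?_)
    simp
  · by_contra! hlt
    have h0 := eq_zero_of_sum_mul_eval_eq_zero hy g' horth (Nat.lt_succ_iff.mp hlt)
    apply hg0
    ext i
    rw [← hinj.extend_apply g 0 i]
    exact congrFun h0 _

end ReedSolomon

/-! ### Hermitian self-orthogonal Reed–Solomon codes. -/

section HermitianReedSolomon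

variable {F K : Type*} [Field F] [Fintype F] [Field K] [Fintype K] [Algebra F K] {n : ℕ}

omit [Fintype K] in
theorem herm_grsEncode_eq_zero {v y : Fin n → K} {r : ℕ}
    (h : ∀ j < r, ∀ l < r,
      ∑ i, v i ^ (Fintype.card F + 1) * y i ^ (Fintype.card F * j + l) = 0)
    (f g : degreeLT K r) :
    herm (Fintype.card F) (grsEncode v y r f) (grsEncode v y r g) = 0 := by
  simp only [herm, grsEncode_apply, eval_eq_sum_degreeLTEquiv f.2, eval_eq_sum_degreeLTEquiv g.2,
    mul_pow, sum_pow_card_field F, Finset.mul_sum, Finset.sum_mul]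
  rw [Finset.sum_comm]
  refine Finset.sum_eq_zero fun j _ => ?_
  rw [Finset.sum_comm]
  refine Finset.sum_eq_zero fun l _ => ?_
  have key := h j j.2 l l.2
  rw [← mul_zero (degreeLTEquiv K r ⟨f, f.2⟩ l *
    degreeLTEquiv K r ⟨g, g.2⟩ j ^ Fintype.card F), ← key, Finset.mul_sum]
  exact Finset.sum_congr rfl fun i _ => by ring

theorem exists_isQuantumCode_of_points {p : ℕ} [Fact p.Prime] [DecidableEq F]
    [Algebra (ZMod p) F]
    {ζ : ℂ} (hζ : IsPrimitiveRoot ζ p) (hodd : Odd (Fintype.card F))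
    (hK : Fintype.card K = Fintype.card F ^ 2) (h2 : (2 : F) ≠ 0) {v y : Fin n → K} {r k : ℕ}
    (hv : ∀ i, v i ≠ 0) (hy : Function.Injective y) (hr : r + 1 ≤ n) (hn : 2 * r + k = n)
    (h : ∀ j < r, ∀ l < r,
      ∑ i, v i ^ (Fintype.card F + 1) * y i ^ (Fintype.card F * j + l) = 0) :
    ∃ Q : Submodule ℂ (StateSpace F n), IsQuantumCode p ζ Q k (r + 1) := by
  classical
  have hinj := grsEncode_injective hv hy (Nat.le_of_succ_le hr)
  have hq : Fintype.card F ≠ 0 := Fintype.card_ne_zero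
  have hdual : ∀ w : Fin n → K,
      (∀ u ∈ LinearMap.range (grsEncode v y r), herm (Fintype.card F) u w = 0) ↔
        ∀ f ∈ degreeLT K r, ∑ i, (v i * w i ^ Fintype.card F) * f.eval (y i) = 0 := by
    intro w
    have : ∀ f : degreeLT K r, herm (Fintype.card F) (grsEncode v y r f) w =
        ∑ i, (v i * w i ^ Fintype.card F) * (f : K[X]).eval (y i) := fun f =>
      Finset.sum_congr rfl fun i _ => by rw [grsEncode_apply]; ring
    constructor
    · intro hw f hf
      rw [← this ⟨f, hf⟩]
      exact hw _ ⟨_, rfl⟩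
    · rintro hw _ ⟨f, rfl⟩
      rw [this]
      exact hw f f.2
  refine exists_isQuantumCode_of_herm hζ hodd hK h2 (LinearMap.range (grsEncode v y r)) ?_
    r.succ_pos ?_ ?_ ?_
  · rintro _ ⟨f, rfl⟩ _ ⟨g, rfl⟩
    exact herm_grsEncode_eq_zero h f g
  · rw [LinearMap.finrank_range_of_inj hinj, finrank_degreeLT, hn]
  · intro w hw hwt
    have h0 := eq_zero_of_sum_mul_eval_eq_zero hy _ ((hdual w).mp hw)
      (by simpa [hv, hq] using Nat.lt_succ_iff.mp hwt)
    ext i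
    simpa [hv, hq] using congrFun h0 i
  · obtain ⟨g, hg, hgwt⟩ := exists_sum_mul_eval_eq_zero hy hr
    have hwt : (Finset.univ.filter fun i => (g i / v i) ^ Fintype.card F ≠ 0).card = r + 1 := by
      rw [← hgwt]
      simp [hv, hq]
    -- The `q`-th power map is an involution of `K`, so this `w` satisfies `v i * w i ^ q = g i`.
    refine ⟨fun i => (g i / v i) ^ Fintype.card F, ?_, ?_, hwt⟩
    · rw [hdual]
      intro f hf
      rw [← hg f hf]
      refine Finset.sum_congr rfl fun i _ => ?_
      rw [pow_card_pow_card hK, mul_div_cancel₀ _ (hv i)]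
    · rintro hk ⟨f, hf⟩
      have hsplit := Finset.card_filter_add_card_filter_not (s := (Finset.univ : Finset (Fin n)))
        (fun i => grsEncode v y r f i = 0)
      have hwt' : (Finset.univ.filter fun i => ¬ grsEncode v y r f i = 0).card = r + 1 := by
        rw [hf]
        exact hwt
      rw [hwt', Finset.card_univ, Fintype.card_fin] at hsplit
      -- There are `n - (r+1) = r + k - 1` zeros, at least `r` because `k ≠ 0`.
      have h0 := eq_zero_of_card_zeros hv hy f (by omega)
      simp [h0] at hwt'

end HermitianReedSolomon

/-! ### Evaluation points and power sums. -/

section Points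

theorem exists_isPrimitiveRoot_of_dvd {K : Type*} [Field K] [Fintype K] {N : ℕ}
    (hN : N ∣ Fintype.card K - 1) : ∃ θ : K, IsPrimitiveRoot θ N := by
  obtain ⟨g, hg⟩ := IsCyclic.exists_generator (α := Kˣ)
  have hord : orderOf g = Fintype.card K - 1 := by
    rw [orderOf_eq_card_of_forall_mem_zpowers hg, Nat.card_units, Nat.card_eq_fintype_card]
  have hp : IsPrimitiveRoot (g : K) (Fintype.card K - 1) := by
    rw [IsPrimitiveRoot.coe_units_iff, ← hord]
    exact IsPrimitiveRoot.orderOf g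
  obtain ⟨c, hc⟩ := hN
  have h1 : 1 < Fintype.card K := Fintype.one_lt_card
  exact ⟨_, hp.pow (by omega) (by rw [hc, mul_comm])⟩

/-- Multiplication by `θ` permutes the roots and scales the sum by `θ^e ≠ 1`. -/
theorem sum_pow_nthRootsFinset {K : Type*} [Field K] {N : ℕ} [NeZero N] {θ : K}
    (hθ : IsPrimitiveRoot θ N) {e : ℕ} (he : ¬ N ∣ e) :
    ∑ x ∈ Polynomial.nthRootsFinset N (1 : K), x ^ e = 0 := by
  have hN : 0 < N := NeZero.pos N
  have hθ0 : θ ≠ 0 := hθ.ne_zero hN.ne'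
  have hsum : ∑ x ∈ Polynomial.nthRootsFinset N (1 : K), (θ * x) ^ e =
      ∑ x ∈ Polynomial.nthRootsFinset N (1 : K), x ^ e := by
    refine Finset.sum_bij' (fun x _ => θ * x) (fun x _ => θ⁻¹ * x) ?_ ?_ ?_ ?_ ?_
    · intro x hx
      rw [Polynomial.mem_nthRootsFinset hN] at hx ⊢
      rw [mul_pow, hx, hθ.pow_eq_one, one_mul]
    · intro x hx
      rw [Polynomial.mem_nthRootsFinset hN] at hx ⊢
      rw [mul_pow, hx, inv_pow, hθ.pow_eq_one, inv_one, one_mul]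
    · intro x _
      exact inv_mul_cancel_left₀ hθ0 x
    · intro x _
      exact mul_inv_cancel_left₀ hθ0 x
    · intro x _
      rfl
  simp only [mul_pow, ← Finset.mul_sum] at hsum
  have h1 : θ ^ e - 1 ≠ 0 := sub_ne_zero.mpr fun h => he (hθ.dvd_of_pow_eq_one e h)
  have h0 : (θ ^ e - 1) * ∑ x ∈ Polynomial.nthRootsFinset N (1 : K), x ^ e = 0 := by
    linear_combination hsum
  exact (mul_eq_zero.mp h0).resolve_left h1

variable {F K : Type*} [Field F] [Fintype F] [Field K] [Fintype K]

/-- Surjectivity of the norm: the exponent `i` of a fixed element `g^i ≠ 0` is a multiple of `q+1`.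
-/
theorem exists_pow_card_add_one_eq (hK : Fintype.card K = Fintype.card F ^ 2) {w : K}
    (hw : w ^ Fintype.card F = w) : ∃ v : K, v ^ (Fintype.card F + 1) = w := by
  have hq : 1 < Fintype.card F := Fintype.one_lt_card
  rcases eq_or_ne w 0 with rfl | hw0
  · exact ⟨0, zero_pow (by omega)⟩
  obtain ⟨g, hg⟩ := IsCyclic.exists_generator (α := Kˣ)
  obtain ⟨i, hi⟩ := mem_powers_iff_mem_zpowers.mpr (hg (Units.mk0 w hw0))
  have hi' : (g : K) ^ i = w := by simpa using congrArg Units.val hi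
  have hord : orderOf g = (Fintype.card F + 1) * (Fintype.card F - 1) := by
    rw [orderOf_eq_card_of_forall_mem_zpowers hg, Nat.card_units, Nat.card_eq_fintype_card, hK,
      ← Nat.sq_sub_sq, one_pow]
  have hw1 : w ^ (Fintype.card F - 1) = 1 := by
    apply mul_right_cancel₀ hw0
    rw [← pow_succ, Nat.sub_add_cancel hq.le, hw, one_mul]
  have hdvd : orderOf g ∣ i * (Fintype.card F - 1) := by
    apply orderOf_dvd_of_pow_eq_one
    ext
    rw [Units.val_pow_eq_pow_val, pow_mul, hi', hw1, Units.val_one]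
  rw [hord] at hdvd
  obtain ⟨c, rfl⟩ := Nat.dvd_of_mul_dvd_mul_right (by omega) hdvd
  exact ⟨(g : K) ^ c, by rw [← pow_mul, mul_comm, hi']⟩

/-- The roots of unity of order `m (q - 1)` whose trace to the field with `q` elements is
nonzero. -/
noncomputable def evalPoints (K : Type*) [Field K] [DecidableEq K] (q m : ℕ) : Finset K :=
  (Polynomial.nthRootsFinset (m * (q - 1)) (1 : K)).filter fun x => x ^ q + x ≠ 0

theorem card_evalPoints [DecidableEq K] (hodd : Odd (Fintype.card F))
    (hK : Fintype.card K = Fintype.card F ^ 2) {m : ℕ} (hm0 : 0 < m) (hm : m ∣ Fintype.card F + 1)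
    (hm2 : Even m) :
    (evalPoints K (Fintype.card F) m).card = (m - 1) * (Fintype.card F - 1) := by
  set q := Fintype.card F
  have hq : 1 < q := Fintype.one_lt_card
  have hcard : Fintype.card K - 1 = (q + 1) * (q - 1) := by
    rw [hK, ← Nat.sq_sub_sq, one_pow]
  have hN : 0 < m * (q - 1) := Nat.mul_pos hm0 (by omega)
  obtain ⟨θ, hθ⟩ := exists_isPrimitiveRoot_of_dvd (K := K) (N := m * (q - 1))
    (hcard ▸ mul_dvd_mul_right hm _)
  obtain ⟨η, hη⟩ := exists_isPrimitiveRoot_of_dvd (K := K) (N := q - 1)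
    (hcard ▸ dvd_mul_left _ _)
  obtain ⟨γ, hγ0, hγ⟩ := exists_pow_card_eq_neg (F := F) (K := K) hodd hK
  have hγ1 : γ ^ (q - 1) = -1 := by
    apply mul_right_cancel₀ hγ0
    rw [← pow_succ, Nat.sub_add_cancel hq.le, hγ, neg_one_mul]
  have hsplit := Finset.card_filter_add_card_filter_not
    (s := Polynomial.nthRootsFinset (m * (q - 1)) (1 : K)) (fun x => x ^ q + x = 0)
  -- The excluded roots are those with `x^(q-1) = -1`, the coset by `γ` of the `(q-1)`-th roots of
  -- unity. They are `N`-th roots because `m` is even.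
  rw [hθ.card_nthRootsFinset] at hsplit
  have hzero : ((Polynomial.nthRootsFinset (m * (q - 1)) (1 : K)).filter
      fun x => x ^ q + x = 0).card = q - 1 := by
    have hq1 : 0 < q - 1 := by omega
    refine Eq.trans (Eq.symm ?_) hη.card_nthRootsFinset
    refine Finset.card_bij (fun x _ => γ * x) ?_ ?_ ?_
    · intro x hx
      rw [Polynomial.mem_nthRootsFinset hq1] at hx
      have hxq : (γ * x) ^ (q - 1) = -1 := by rw [mul_pow, hx, hγ1, mul_one]
      rw [Finset.mem_filter, Polynomial.mem_nthRootsFinset hN]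
      refine ⟨by rw [mul_comm m, pow_mul, hxq, hm2.neg_one_pow], ?_⟩
      rw [← Nat.sub_add_cancel hq.le, pow_succ, hxq]
      ring
    · intro x _ x' _ h
      exact mul_left_cancel₀ hγ0 h
    · intro x hx
      rw [Finset.mem_filter, Polynomial.mem_nthRootsFinset hN] at hx
      have hx0 : x ≠ 0 := by
        rintro rfl
        rw [zero_pow hN.ne'] at hx
        exact zero_ne_one hx.1
      have hxq : x ^ (q - 1) = -1 := by
        apply mul_right_cancel₀ hx0
        rw [← pow_succ, Nat.sub_add_cancel hq.le]
        linear_combination hx.2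
      refine ⟨γ⁻¹ * x, ?_, mul_inv_cancel_left₀ hγ0 x⟩
      rw [Polynomial.mem_nthRootsFinset hq1, mul_pow, inv_pow, hγ1, hxq]
      norm_num
  rw [hzero] at hsplit
  rw [Nat.sub_mul, one_mul]
  exact Nat.eq_sub_of_add_eq' hsplit

theorem sum_evalPoints [DecidableEq K] (hK : Fintype.card K = Fintype.card F ^ 2) {a m r : ℕ}
    (hq : Fintype.card F + 1 = (2 * a + 1) * m) (hr : r + 2 ≤ (a + 1) * m) (hm : 2 ≤ m)
    {j l : ℕ} (hj : j < r) (hl : l < r) :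
    ∑ x ∈ evalPoints K (Fintype.card F) m,
      (x ^ Fintype.card F + x) * x ^ (Fintype.card F * j + l) = 0 := by
  set q := Fintype.card F
  have hq1 : 1 < q := Fintype.one_lt_card
  have hcard : Fintype.card K - 1 = (q + 1) * (q - 1) := by
    rw [hK, ← Nat.sq_sub_sq, one_pow]
  obtain ⟨θ, hθ⟩ := exists_isPrimitiveRoot_of_dvd (K := K) (N := m * (q - 1))
    (hcard ▸ mul_dvd_mul_right (hq ▸ dvd_mul_left _ _) _)
  have : NeZero (m * (q - 1)) := ⟨Nat.mul_ne_zero (by omega) (by omega)⟩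
  -- The values `s = 1, 2` correspond to the terms `x` and `x^q` of the weight. Divisibility by
  -- `q-1` forces `j+l+1 = q-1`, so `e = (q-1)(j+s)` and `m ∣ j+s`. The bounds on `j` and `l` put
  -- `j+s` strictly between `am` and `(a+1)m`.
  have key : ∀ e s : ℕ, (s = 1 ∨ s = 2) → e = (q - 1) * (j + s - 1) + (j + l + 1) →
      ¬ m * (q - 1) ∣ e := by
    intro e s hs he hdvd
    have h1 : q - 1 ∣ j + l + 1 :=
      (Nat.dvd_add_right (dvd_mul_right _ _)).mp (he ▸ (dvd_mul_left _ _).trans hdvd)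
    have hsum : j + l + 1 = q - 1 := by
      obtain ⟨c, hc⟩ := h1
      have hm' : m ≤ q + 1 := Nat.le_of_dvd (by omega) (hq ▸ dvd_mul_left _ _)
      have hlt : j + l + 1 < (q - 1) * 2 := by
        have : 2 * ((a + 1) * m) = q + 1 + m := by rw [hq]; ring
        omega
      rw [hc] at hlt
      have hc2 : c < 2 := Nat.lt_of_mul_lt_mul_left hlt
      interval_cases c
      · omega
      · omega
    rw [hsum, ← Nat.mul_succ] at he
    rw [he, mul_comm m] at hdvd
    have hms : m ∣ j + s - 1 + 1 := Nat.dvd_of_mul_dvd_mul_left (by omega) hdvd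
    obtain ⟨c, hc⟩ := hms
    have hlo : m * a < m * c := by
      have : (2 * a + 1) * m = m * a + (a + 1) * m := by ring
      omega
    have hhi : m * c < m * (a + 1) := by
      have : (a + 1) * m = m * (a + 1) := by ring
      omega
    have := Nat.lt_of_mul_lt_mul_left hlo
    have := Nat.lt_of_mul_lt_mul_left hhi
    omega
  have hqj : q * j = (q - 1) * j + j := by
    conv_lhs => rw [← Nat.sub_add_cancel hq1.le]
    ring
  -- The weight vanishes at the excluded roots, so the sum extends to all roots of unity.
  rw [evalPoints, Finset.sum_filter_of_ne (p := fun x => x ^ q + x ≠ 0)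
    fun x _ hx => left_ne_zero_of_mul hx]
  simp only [add_mul, ← pow_add, Finset.sum_add_distrib]
  rw [sum_pow_nthRootsFinset hθ (key (q + (q * j + l)) 2 (Or.inr rfl) ?_)]
  · simp only [← pow_succ']
    rw [sum_pow_nthRootsFinset hθ (key (q * j + l + 1) 1 (Or.inl rfl) ?_), zero_add]
    rw [hqj, Nat.add_sub_cancel]
    ring
  · rw [hqj, show j + 2 - 1 = j + 1 by omega, mul_add, mul_one]
    omega

end Points

end QuantumMDS

/-! ### Assembly of the parameters. -/

open QuantumMDS

theorem mainTheorem3 (p : ℕ) (hp : p.Prime) (ζ : ℂ) (hζ : IsPrimitiveRoot ζ p)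
    (F : Type*) [Field F] [Fintype F] [DecidableEq F] [Algebra (ZMod p) F]
    (q : ℕ) (hF : Fintype.card F = q) (hodd : Odd q)
    (a m : ℕ) (hq : (q : ℤ) = (2 * (a : ℤ) + 1) * (m : ℤ) - 1)
    (d : ℕ) (hd2 : 2 ≤ d) (hd : (d : ℤ) ≤ ((a : ℤ) + 1) * (m : ℤ) - 1) :
    ∃ n k : ℕ,
      (n : ℚ) = ((q : ℚ) ^ 2 - 1) / (2 * (a : ℚ) + 1) - (q : ℚ) + 1 ∧
      (k : ℚ) = ((q : ℚ) ^ 2 - 1) / (2 * (a : ℚ) + 1) - (q : ℚ) - 2 * (d : ℚ) + 3 ∧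
      ∃ Q : Submodule ℂ (QuantumMDS.StateSpace F n), QuantumMDS.IsQuantumMDSCode p ζ Q k d := by
  classical
  subst hF
  have := Fact.mk hp
  have : CharP F p := charP_of_injective_algebraMap (algebraMap (ZMod p) F).injective p
  let K := FiniteField.Extension F p 2
  have : Finite K := Module.finite_of_finite F
  have : Fintype K := Fintype.ofFinite K
  have hK : Fintype.card K = Fintype.card F ^ 2 := by
    rw [← Nat.card_eq_fintype_card, ← Nat.card_eq_fintype_card]
    exact FiniteField.natCard_extension F p 2
  have hq1 : 1 < Fintype.card F := Fintype.one_lt_card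
  have hqn : Fintype.card F + 1 = (2 * a + 1) * m := by
    zify
    linarith
  have hdn : d + 1 ≤ (a + 1) * m := by
    zify
    linarith
  have hm2 : Even m := by
    have h : Even ((2 * a + 1) * m) := hqn ▸ hodd.add_one
    rcases Nat.even_mul.mp h with h | h
    · exact absurd h (by simp)
    · exact h
  have hm0 : 2 ≤ m := by
    obtain ⟨t, rfl⟩ := hm2
    rcases Nat.eq_zero_or_pos t with rfl | ht
    · simp at hqn
    · omega
  have h2 : (2 : F) ≠ 0 := by
    apply Ring.two_ne_zero
    intro hchar
    have := FiniteField.even_card_of_char_two hchar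
    rw [Nat.odd_iff] at hodd
    omega
  have hcard := card_evalPoints (K := K) hodd hK (by omega) (hqn ▸ dvd_mul_left _ _) hm2
  set n := (m - 1) * (Fintype.card F - 1) with hn
  -- Makes `k` a natural number: `2(d-1) ≤ q+m-3`, and `n - (q+m-3) = (m-2)(q-2) ≥ 0`.
  have hnd : 2 * (d - 1) ≤ n := by
    have h3 : 2 * ((a + 1) * m) = Fintype.card F + 1 + m := by rw [hqn]; ring
    have h4 : 3 ≤ Fintype.card F := by
      obtain ⟨t, ht⟩ := hodd
      omega
    obtain ⟨m', rfl⟩ := Nat.exists_eq_add_of_le hm0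
    obtain ⟨q', hq'⟩ := Nat.exists_eq_add_of_le h4
    rw [hq'] at h3 hn
    have : n = (m' + 1) * (q' + 2) := by
      rw [hn]
      congr 1 <;> omega
    have : n = m' * q' + 2 * m' + q' + 2 := by rw [this]; ring
    have : 0 ≤ m' * q' := Nat.zero_le _
    omega
  have hqQ : ((Fintype.card F : ℚ)) + 1 = (2 * a + 1) * m := by exact_mod_cast hqn
  have hnQ : (n : ℚ) = ((Fintype.card F : ℚ) ^ 2 - 1) / (2 * (a : ℚ) + 1)
      - (Fintype.card F : ℚ) + 1 := by
    have h0 : (2 * (a : ℚ) + 1) ≠ 0 := by positivity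
    rw [hn, Nat.cast_mul, Nat.cast_sub (by omega), Nat.cast_sub hq1.le]
    field_simp
    push_cast
    linear_combination (-(Fintype.card F : ℚ) + 1) * hqQ
  refine ⟨n, n - 2 * (d - 1), hnQ, ?_, ?_⟩
  · rw [Nat.cast_sub hnd, hnQ, Nat.cast_mul, Nat.cast_sub (by omega)]
    push_cast
    ring
  let y : Fin n → K := fun i => ((evalPoints K (Fintype.card F) m).equivFinOfCardEq hcard).symm i
  have hy : Function.Injective y := Subtype.val_injective.comp (Equiv.injective _)
  have hy0 : ∀ i, y i ^ Fintype.card F + y i ≠ 0 := fun i =>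
    (Finset.mem_filter.mp (Subtype.property
      (((evalPoints K (Fintype.card F) m).equivFinOfCardEq hcard).symm i))).2
  -- Frobenius swaps the two terms of `y^q + y`, so the weight is fixed and is a norm.
  have hv : ∀ i, ∃ v : K, v ^ (Fintype.card F + 1) = y i ^ Fintype.card F + y i := fun i =>
    exists_pow_card_add_one_eq hK (by
      rw [add_pow_card_field F, pow_card_pow_card hK, add_comm])
  choose v hv using hv
  have hv0 : ∀ i, v i ≠ 0 := by
    intro i h0
    apply hy0 i
    rw [← hv i, h0, zero_pow (by omega)]
  obtain ⟨Q, hQ⟩ := exists_isQuantumCode_of_points (F := F) (r := d - 1) (k := n - 2 * (d - 1))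
    hζ hodd hK h2 hv0 hy (by omega) (by omega) (by
      intro j hj l hl
      simp only [hv]
      rw [← sum_evalPoints (K := K) (j := j) (l := l) hK hqn (by omega) hm0 hj hl,
        ← Finset.sum_coe_sort (evalPoints K (Fintype.card F) m)]
      exact Equiv.sum_comp ((evalPoints K (Fintype.card F) m).equivFinOfCardEq hcard).symm
        fun x : evalPoints K (Fintype.card F) m =>
          ((x : K) ^ Fintype.card F + x) * (x : K) ^ (Fintype.card F * j + l))
  rw [Nat.sub_add_cancel (by omega)] at hQ
  refine ⟨Q, hQ, ?_⟩
  rw [Nat.cast_sub hnd]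
  push_cast [Nat.cast_sub (show 1 ≤ d by omega)]
  ring
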